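/- All rings are commutative. Let $R$ be a ring, $\mathfrak a$ an ideal of $R$ and $M$ an $R$-module. A finite sequence $x_1,\dots,x_\ell$ in $R$ is a weak regular sequence on $M$ if $x_i$ is a nonzerodivisor on $M/(x_1,\dots,x_{i-1})M$ for $1\le i\le \ell$. The classical grade $\operatorname{c.grade}_R(\mathfrak a,M)\in\mathbb N\cup\{\infty\}$ is the supremum of the lengths of all weak regular sequences on $M$ contained in $\mathfrak a$, and the polynomial grade is $$\operatorname{p.grade}_R(\mathfrak a,M):=\lim_{m\to\infty}\operatorname{c.grade}_{R[t_1,\dots,t_m]}\bigl(\mathfrak aR[t_1,\dots,t_m],\,R[t_1,\dots,t_m]\otimes_R M\bigr).$$ A Noetherian ring $R$ is Cohen-Macaulay if $\operatorname{depth}R_{\mathfrak m}=\dim R_{\mathfrak m}$ for every maximal ideal $\mathfrak m$ of $R$. **Proposition 3.5.** Let $\{A_\gamma:\gamma\in\Gamma\}$ be a direct system of Noetherian Cohen-Macaulay rings over a nonempty directed index set $\Gamma$, and let $\mathfrak p$ be a prime ideal of $A:=\varinjlim_{\gamma\in\Gamma}A_\gamma$. For $\gamma\in\Gamma$ let $\mathfrak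 p_\gamma=\mathfrak p\cap A_\gamma$ be the preimage of $\mathfrak p$ under the canonical map $A_\gamma\to A$. Assume that one of the following holds: (i) $\operatorname{c.grade}_{A_\gamma}(\mathfrak p_\gamma,A_\gamma)=\operatorname{c.grade}_{A_\gamma}(\mathfrak p_\delta A_\gamma,A_\gamma)$ for all $\delta\le\gamma$ in $\Gamma$; (ii) $\operatorname{c.grade}_{A_\delta}(\mathfrak p_\delta,A_\delta)\le\operatorname{c.grade}_{A_\gamma}(\mathfrak p_\delta A_\gamma,A_\gamma)$ for all $\delta\le\gamma$ in $\Gamma$. Then $\operatorname{p.grade}_A(\mathfrak p,A)=\operatorname{ht}_A(\mathfrak p)$, as an equality in $\mathbb N\cup\{\infty\}$. -/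

import Mathlib

open scoped TensorProduct Topology

/-- The classical grade of an ideal `I` of `R` on an `R`-module `M`: the supremum in `ℕ∞` of the
lengths of the weak regular sequences on `M` that are contained in `I`. (For a weak regular
sequence `x₁, …, xₗ` on `M`, the module `M / (x₁, …, xₗ) M` is allowed to be zero.) -/
noncomputable def classicalGrade {R : Type*} [CommRing R] (I : Ideal R)
    (M : Type*) [AddCommGroup M] [Module R M] : ℕ∞ :=
  ⨆ (rs : List R) (_ : ∀ r ∈ rs, r ∈ I) (_ : RingTheory.Sequence.IsWeaklyRegular M rs),
    (rs.length : ℕ∞)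

/-- The classical grade of `I R[t₁, …, tₘ]` on `R[t₁, …, tₘ] ⊗ M`. -/
noncomputable def classicalGradeMvPolynomial {R : Type*} [CommRing R] (I : Ideal R)
    (M : Type*) [AddCommGroup M] [Module R M] (m : ℕ) : ℕ∞ :=
  classicalGrade (I.map (MvPolynomial.C : R →+* MvPolynomial (Fin m) R))
    (MvPolynomial (Fin m) R ⊗[R] M)

/-- The polynomial grade of an ideal `I` of `R` on an `R`-module `M`, that is, the limit for
`m → ∞` of the classical grade of `I R[t₁, …, tₘ]` on `R[t₁, …, tₘ] ⊗ M`. The sequence is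
nondecreasing, so its limit in `ℕ∞` is its supremum; see `tendsto_polynomialGrade`. -/
noncomputable def polynomialGrade {R : Type*} [CommRing R] (I : Ideal R)
    (M : Type*) [AddCommGroup M] [Module R M] : ℕ∞ :=
  ⨆ m : ℕ, classicalGradeMvPolynomial I M m

theorem monotone_classicalGradeMvPolynomial {R : Type*} [CommRing R] (I : Ideal R)
    (M : Type*) [AddCommGroup M] [Module R M] : Monotone (classicalGradeMvPolynomial I M) := by
  refine monotone_nat_of_le_succ fun m => ?_
  let S := MvPolynomial (Fin m) R
  let T := MvPolynomial (Fin (m + 1)) R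
  let g : S →ₐ[R] T := ((MvPolynomial.finSuccEquiv R m).symm : Polynomial S →ₐ[R] T).comp
    (IsScalarTower.toAlgHom R S (Polynomial S))
  algebraize [g.toRingHom]
  have : IsScalarTower R S T := IsScalarTower.of_algebraMap_eq fun r => (g.commutes r).symm
  let e : Polynomial S ≃ₗ[S] T :=
    { (MvPolynomial.finSuccEquiv R m).symm.toAddEquiv with
      map_smul' := fun s p => by
        change (MvPolynomial.finSuccEquiv R m).symm (s • p)
          = g s * (MvPolynomial.finSuccEquiv R m).symm p
        rw [Algebra.smul_def, map_mul]
        rfl }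
  have : Module.Flat S T := Module.Flat.of_linearEquiv e.symm
  refine iSup_le fun rs => iSup_le fun hrs => iSup_le fun hreg => ?_
  let φ : (S ⊗[R] M) →ₗ[S] (T ⊗[R] M) :=
    TensorProduct.AlgebraTensorModule.rTensor R M (Algebra.linearMap S T)
  have hφ : IsBaseChange T φ := by
    refine IsBaseChange.of_equiv
      (TensorProduct.AlgebraTensorModule.cancelBaseChange R S T T M) fun x => ?_
    induction x using TensorProduct.induction_on with
    | zero => simp
    | tmul s y => simp [φ, Algebra.smul_def]
    | add x y hx hy => simp only [TensorProduct.tmul_add, map_add, hx, hy]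
  have hreg' := hreg.of_flat_of_isBaseChange hφ
  have hmem : ∀ r ∈ rs.map (algebraMap S T),
      r ∈ I.map (MvPolynomial.C : R →+* MvPolynomial (Fin (m + 1)) R) := by
    intro r hr
    obtain ⟨s, hs, rfl⟩ := List.mem_map.mp hr
    have h1 := Ideal.mem_map_of_mem (algebraMap S T) (hrs s hs)
    rw [Ideal.map_map] at h1
    have h2 : (algebraMap S T).comp MvPolynomial.C = (MvPolynomial.C : R →+* T) :=
      RingHom.ext fun r => g.commutes r
    rwa [h2] at h1
  refine le_trans ?_ (le_iSup_of_le (rs.map (algebraMap S T))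
    (le_iSup_of_le hmem (le_iSup_of_le hreg' le_rfl)))
  simp

/-- The polynomial grade is the limit of the classical grades over the polynomial extensions. -/
theorem tendsto_polynomialGrade {R : Type*} [CommRing R] (I : Ideal R)
    (M : Type*) [AddCommGroup M] [Module R M] :
    Filter.Tendsto (classicalGradeMvPolynomial I M) Filter.atTop (𝓝 (polynomialGrade I M)) :=
  tendsto_atTop_iSup (monotone_classicalGradeMvPolynomial I M)

/-- A Noetherian Cohen-Macaulay ring: a Noetherian ring `R` such that, for every maximal ideal
`m`, the local ring `R_m` has depth equal to its Krull dimension. (The depth of the local ring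
`R_m` is the classical grade of its maximal ideal on `R_m`.) -/
structure IsNoetherianCohenMacaulay (R : Type*) [CommRing R] : Prop where
  isNoetherianRing : IsNoetherianRing R
  depth_eq_ringKrullDim : ∀ (m : Ideal R) [m.IsMaximal],
    ((classicalGrade (IsLocalRing.maximalIdeal (Localization.AtPrime m))
      (Localization.AtPrime m) : ℕ∞) : WithBot ℕ∞) = ringKrullDim (Localization.AtPrime m)

/-! ### Vanishing of Ext and weakly regular sequences. -/

section ExtRegular

open CategoryTheory Abelian RingTheory.Sequence Pointwise

universe u

variable {R : Type u} [CommRing R]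

/-! The inequality p.grade ≤ ht holds for a prime of any commutative ring
(`polynomialGrade_le_height`). Localize at `p`, of finite height `n`. Kronecker's theorem without
Noetherian hypotheses (`exists_forall_mem_radical_ofList`) puts the coefficients of a given weakly
regular sequence in the radical of an ideal generated by `n` elements of the maximal ideal. If the
sequence were longer than `n`, this ideal would become the unit ideal over the polynomial ring
(`ofList_eq_top_of_isWeaklyRegular`, an Ext computation), which is absurd.

For the other inequality let `n ≤ ht p`. A chain of `n` strict inclusions of primes below `p` is
already strict at some stage `δ` and at all later ones (`exists_forall_le_height_comap`). Height is
at most grade in a Cohen-Macaulay ring, so either hypothesis makes the grade of the extension of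
`p_δ` at least `n` at every `γ ≥ δ`.

The sequences witnessing this at different stages are unrelated. They are replaced by universal
ones: if `a` is a finite family generating `p_δ`, take the polynomial `∑ a_i X^i`, pass to the
quotient by it, and repeat with a new variable. These polynomials are compatible with the transition
maps. They are regular at each stage by an exchange argument
(`genericallyRegular_of_isWeaklyRegular`), and their regularity passes to the colimit
(`GenericallyRegular.of_isRingColimit`), giving a weakly regular sequence of length `n` in a
polynomial extension of `p`. -/

theorem smul_ext_eq_zero {N M : ModuleCat.{u} R} {r : R}
    (hr : r ∈ Module.annihilator R N ⊔ Module.annihilator R M) {i : ℕ} (x : Ext N M i) :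
    r • x = 0 := by
  obtain ⟨a, ha, b, hb, rfl⟩ := Submodule.mem_sup.mp hr
  have h1 : a • 𝟙 N = 0 := by
    simp [← ModuleCat.lsmul_eq_smul_id, Module.mem_annihilator_iff_lsmul_eq_zero.mp ha]
  have h2 : b • 𝟙 M = 0 := by
    simp [← ModuleCat.lsmul_eq_smul_id, Module.mem_annihilator_iff_lsmul_eq_zero.mp hb]
  have h3 : a • x = (Ext.mk₀ (a • 𝟙 N)).comp x (zero_add i) := by simp [Ext.mk₀_smul]
  have h4 : b • x = x.comp (Ext.mk₀ (b • 𝟙 M)) (add_zero i) := by simp [Ext.mk₀_smul]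
  rw [add_smul, h3, h4, h1, h2]
  simp

/-- If `r` is regular on `M`, and `Ext N (M / r M)` vanishes in degree `i`, then `r` is regular on
`Ext N M` in degree `i + 1`. -/
theorem smul_ext_succ_injective {N M : ModuleCat.{u} R} {r : R} (hr : IsSMulRegular M r) (i : ℕ)
    (h : Subsingleton (Ext N (ModuleCat.of R (QuotSMulTop r M)) i)) {x : Ext N M (i + 1)}
    (hx : r • x = 0) : x = 0 := by
  obtain ⟨y, rfl⟩ := Ext.covariant_sequence_exact₁ N hr.smulShortComplex_shortExact x
    (show x.comp (Ext.mk₀ (r • 𝟙 M)) _ = 0 by simpa [Ext.mk₀_smul] using hx) rfl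
  obtain rfl : y = 0 := @Subsingleton.elim _ h y 0
  apply Ext.zero_comp

theorem ext_zero_eq_zero_of_smul {N M : ModuleCat.{u} R} {r : R} (hr : IsSMulRegular M r)
    {x : Ext N M 0} (hx : r • x = 0) : x = 0 := by
  have : Mono (r • 𝟙 M) := hr.smulShortComplex_shortExact.mono_f
  apply Ext.postcomp_mk₀_injective_of_mono N (r • 𝟙 M)
  simpa [Ext.mk₀_smul] using hx

theorem eq_zero_of_pow_smul_eq_zero {E : Type*} [AddCommGroup E] [Module R E] {r : R}
    (h : ∀ x : E, r • x = 0 → x = 0) (k : ℕ) {x : E} (hx : r ^ k • x = 0) : x = 0 := by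
  induction k with
  | zero => simpa using hx
  | succ k ih =>
    rw [pow_succ', mul_smul] at hx
    exact ih (h _ hx)

theorem annihilator_le_annihilator_quotSMulTop (r : R) (M : Type*) [AddCommGroup M] [Module R M] :
    Module.annihilator R M ≤ Module.annihilator R (QuotSMulTop r M) :=
  LinearMap.annihilator_le_of_surjective (Submodule.mkQ _) (Submodule.mkQ_surjective _)

/-- A weakly regular sequence on `M` consisting of elements a power of which annihilates `N` or `M`
forces the vanishing of `Ext N M` in low degrees. -/
theorem subsingleton_ext_of_isWeaklyRegular (N M : ModuleCat.{u} R) (rs : List R)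
    (hrs : ∀ r ∈ rs, r ∈ (Module.annihilator R N ⊔ Module.annihilator R M).radical)
    (hreg : IsWeaklyRegular M rs) (i : ℕ) (hi : i < rs.length) : Subsingleton (Ext N M i) := by
  induction rs generalizing M i with
  | nil => simp at hi
  | cons r rs ih =>
    rw [isWeaklyRegular_cons_iff] at hreg
    obtain ⟨k, hk⟩ := hrs r List.mem_cons_self
    refine ⟨fun x y => sub_eq_zero.mp ?_⟩
    generalize x - y = x
    cases i with
    | zero =>
      exact eq_zero_of_pow_smul_eq_zero (fun x => ext_zero_eq_zero_of_smul hreg.1) k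
        (smul_ext_eq_zero hk x)
    | succ i =>
      refine eq_zero_of_pow_smul_eq_zero (fun x => smul_ext_succ_injective hreg.1 i ?_) k
        (smul_ext_eq_zero hk x)
      refine ih (ModuleCat.of R (QuotSMulTop r M)) (fun s hs => ?_) hreg.2 i (by simpa using hi)
      exact Ideal.radical_mono (sup_le_sup_left (annihilator_le_annihilator_quotSMulTop r M) _)
        (hrs s (List.mem_cons_of_mem _ hs))

theorem subsingleton_ext_quotSMulTop {N M : ModuleCat.{u} R} {r : R} (hr : IsSMulRegular M r)
    (i : ℕ) (h : Subsingleton (Ext N M i)) (h' : Subsingleton (Ext N M (i + 1))) :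
    Subsingleton (Ext N (ModuleCat.of R (QuotSMulTop r M)) i) := by
  refine ⟨fun x y => sub_eq_zero.mp ?_⟩
  generalize x - y = x
  obtain ⟨y, rfl⟩ := Ext.covariant_sequence_exact₃ N hr.smulShortComplex_shortExact x
    rfl (@Subsingleton.elim _ h' _ _)
  obtain rfl : y = 0 := @Subsingleton.elim _ h y 0
  apply Ext.zero_comp

theorem isWeaklyRegular_replicate_of_smul_eq_self {M : Type u} [AddCommGroup M] [Module R M] {r : R}
    (hr : ∀ x : M, r • x = x) (n : ℕ) : IsWeaklyRegular M (List.replicate n r) := by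
  induction n generalizing M with
  | zero => simp
  | succ n ih =>
    rw [List.replicate_succ, isWeaklyRegular_cons_iff]
    refine ⟨fun x y hxy => by simpa [hr] using hxy, ih fun x => ?_⟩
    obtain ⟨x, rfl⟩ := Submodule.mkQ_surjective _ x
    rw [← map_smul, hr]

/-- Exchange: in the Noetherian situation, the quotient by any regular element of an ideal lowers
the length of the regular sequences contained in the ideal by at most one. -/
theorem exists_isWeaklyRegular_quotSMulTop [IsNoetherianRing R] (I : Ideal R) (M : Type u)
    [AddCommGroup M] [Module R M] [Module.Finite R M] (n : ℕ) (rs : List R)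
    (hlen : n + 1 ≤ rs.length) (hrs : ∀ r ∈ rs, r ∈ I) (hreg : IsWeaklyRegular M rs) (h : R)
    (hM : IsSMulRegular M h) :
    ∃ ss : List R, ss.length = n ∧ (∀ r ∈ ss, r ∈ I) ∧ IsWeaklyRegular (QuotSMulTop h M) ss := by
  by_cases hI : I • (⊤ : Submodule R (QuotSMulTop h M)) = ⊤
  · obtain ⟨e, he, he'⟩ := Submodule.exists_mem_and_smul_eq_self_of_fg_of_le_smul I
      (⊤ : Submodule R (QuotSMulTop h M)) Module.Finite.fg_top hI.ge
    exact ⟨List.replicate n e, by simp, fun r hr => List.eq_of_mem_replicate hr ▸ he,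
      isWeaklyRegular_replicate_of_smul_eq_self (fun x => he' x trivial) n⟩
  · have hann : Module.annihilator R (R ⧸ I) = I := Ideal.annihilator_quotient
    have hext (i : ℕ) (hi : i < n) :
        Subsingleton (Ext (ModuleCat.of R (R ⧸ I)) (ModuleCat.of R (QuotSMulTop h M)) i) := by
      have key := subsingleton_ext_of_isWeaklyRegular (ModuleCat.of R (R ⧸ I))
        (ModuleCat.of R M) rs (fun r hr => Ideal.le_radical (Ideal.mem_sup_left
          (by rw [hann]; exact hrs r hr))) hreg
      exact subsingleton_ext_quotSMulTop (M := ModuleCat.of R M) hM i (key i (by omega))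
        (key (i + 1) (by omega))
    obtain ⟨ss, h1, h2, h3⟩ := ModuleCat.exists_isRegular_of_exists_subsingleton_ext I n
      (ModuleCat.of R (QuotSMulTop h M)) (lt_top_iff_ne_top.mpr hI) (ModuleCat.of R (R ⧸ I))
      (by rw [Module.support_eq_zeroLocus, hann]) hext
    exact ⟨ss, h1, h2, h3.1⟩

open Limits in
-- Dividing by one regular element raises the projective dimension by at most one.
theorem hasProjectiveDimensionLT_quotient_ofList_smul_top (N : Type u) [AddCommGroup N] [Module R N]
    (xs : List R) (hreg : IsWeaklyRegular N xs) (k : ℕ)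
    (hN : HasProjectiveDimensionLT (ModuleCat.of R N) (k + 1)) :
    HasProjectiveDimensionLT
      (ModuleCat.of R (N ⧸ (Ideal.ofList xs • ⊤ : Submodule R N))) (k + xs.length + 1) := by
  induction xs generalizing N k with
  | nil =>
    exact hasProjectiveDimensionLT_of_iso (LinearEquiv.toModuleIso
      (Submodule.quotEquivOfEqBot _ (by simp)).symm) _
  | cons x xs ih =>
    rw [isWeaklyRegular_cons_iff] at hreg
    have h1 : HasProjectiveDimensionLT (ModuleCat.of R (QuotSMulTop x N)) (k + 1 + 1) :=
      ShortComplex.ShortExact.hasProjectiveDimensionLT_X₃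
        (IsSMulRegular.smulShortComplex_shortExact (M := ModuleCat.of R N) hreg.1) (k + 1) hN
        (@hasProjectiveDimensionLT_of_ge _ _ _ (ModuleCat.of R N) (k + 1) (k + 1 + 1)
          (Nat.le_succ _) hN)
    have h2 := ih _ hreg.2 _ h1
    rw [List.length_cons, show k + (xs.length + 1) + 1 = k + 1 + xs.length + 1 by ring]
    exact hasProjectiveDimensionLT_of_iso
      (Submodule.quotOfListConsSMulTopEquivQuotSMulTopInner N x xs).symm.toModuleIso _

/-- Each `x` acts as zero on `Ext N Q`, so in the contravariant sequence of `0 → N → N → N/xN → 0`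
the connecting map embeds degree `k` for `N` into degree `k + 1` for `N/xN`. -/
theorem subsingleton_ext_of_subsingleton_ext_quotient (N : Type u) [AddCommGroup N] [Module R N]
    (Q : ModuleCat.{u} R) (xs : List R) (hreg : IsWeaklyRegular N xs)
    (hQ : ∀ x ∈ xs, x ∈ Module.annihilator R Q) (k : ℕ)
    (h : Subsingleton
      (Ext (ModuleCat.of R (N ⧸ (Ideal.ofList xs • ⊤ : Submodule R N))) Q (k + xs.length))) :
    Subsingleton (Ext (ModuleCat.of R N) Q k) := by
  induction xs generalizing N k with
  | nil =>
    let e : ModuleCat.of R (N ⧸ (Ideal.ofList ([] : List R) • ⊤ : Submodule R N)) ≅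
        ModuleCat.of R N := LinearEquiv.toModuleIso (Submodule.quotEquivOfEqBot _ (by simp))
    refine ⟨fun x y => ?_⟩
    have hxy : (Ext.mk₀ e.hom).comp x (zero_add k) = (Ext.mk₀ e.hom).comp y (zero_add k) :=
      Subsingleton.elim (α := Ext _ Q (k + 0)) _ _
    simpa using congrArg (fun z => (Ext.mk₀ e.inv).comp z (zero_add k)) hxy
  | cons x xs ih =>
    rw [isWeaklyRegular_cons_iff] at hreg
    let e : ModuleCat.of R (N ⧸ (Ideal.ofList (x :: xs) • ⊤ : Submodule R N)) ≅
        ModuleCat.of R (QuotSMulTop x N ⧸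
          (Ideal.ofList xs • ⊤ : Submodule R (QuotSMulTop x N))) :=
      (Submodule.quotOfListConsSMulTopEquivQuotSMulTopInner N x xs).toModuleIso
    have h1 : Subsingleton (Ext (ModuleCat.of R (QuotSMulTop x N)) Q (k + 1)) := by
      refine ih (QuotSMulTop x N) hreg.2 (fun y hy => hQ y (List.mem_cons_of_mem _ hy)) (k + 1) ?_
      rw [List.length_cons, show k + (xs.length + 1) = k + 1 + xs.length by ring] at h
      refine ⟨fun x y => ?_⟩
      have hxy : (Ext.mk₀ e.hom).comp x (zero_add _) = (Ext.mk₀ e.hom).comp y (zero_add _) :=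
        Subsingleton.elim _ _
      simpa using congrArg (fun z => (Ext.mk₀ e.inv).comp z (zero_add _)) hxy
    refine ⟨fun y z => sub_eq_zero.mp ?_⟩
    generalize y - z = y
    obtain ⟨z, rfl⟩ := Ext.contravariant_sequence_exact₁
      (IsSMulRegular.smulShortComplex_shortExact (M := ModuleCat.of R N) hreg.1) Q y (add_comm 1 k)
      (@Subsingleton.elim _ h1 _ _)
    have h2 (z : Ext (ModuleCat.of R N) Q k) :
        (Ext.mk₀ (x • 𝟙 (ModuleCat.of R N))).comp z (zero_add k) = x • z := by
      simp [Ext.mk₀_smul]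
    exact (h2 z).trans (smul_ext_eq_zero (Ideal.mem_sup_right (hQ x List.mem_cons_self)) z)

/-- If `x₁, …, xₙ` is weakly regular on the ring and the ideal it generates contains, up to radical
and modulo the annihilator of `M`, a weakly `M`-regular sequence of length greater than `n`, then
`M = (x₁, …, xₙ) M`. -/
theorem ofList_smul_top_eq_top_of_isWeaklyRegular (M : Type u) [AddCommGroup M] [Module R M]
    (xs rs : List R) (hxs : IsWeaklyRegular R xs) (hlen : xs.length < rs.length)
    (hrs : ∀ r ∈ rs, r ∈ (Ideal.ofList xs ⊔ Module.annihilator R M).radical)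
    (hreg : IsWeaklyRegular M rs) : Ideal.ofList xs • (⊤ : Submodule R M) = ⊤ := by
  -- With `n = xs.length` and `I = (xs)`, Ext from `R/I` to `M` vanishes in degree `n` because `rs`
  -- is longer, and Ext to `IM` vanishes in degree `n + 1` by projective dimension. Hence Ext to
  -- `M/IM` vanishes in degree `n`; descending along `xs` gives `Hom(R, M/IM) = 0`.
  let N := ModuleCat.of R (R ⧸ (Ideal.ofList xs • ⊤ : Submodule R R))
  let Q := ModuleCat.of R (M ⧸ (Ideal.ofList xs • ⊤ : Submodule R M))
  have hann : Module.annihilator R (R ⧸ (Ideal.ofList xs • ⊤ : Submodule R R)) = Ideal.ofList xs := by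
    rw [smul_eq_mul, Ideal.mul_top]
    exact Ideal.annihilator_quotient
  have h1 : Subsingleton (Ext N (ModuleCat.of R M) xs.length) :=
    subsingleton_ext_of_isWeaklyRegular N (ModuleCat.of R M) rs
      (fun r hr => by rw [show Module.annihilator R N = _ from hann]; exact hrs r hr) hreg _ hlen
  have hpd : HasProjectiveDimensionLT N (xs.length + 1) := by
    have := hasProjectiveDimensionLT_quotient_ofList_smul_top R xs hxs 0
      (projective_iff_hasProjectiveDimensionLT_one.mp
        ((IsProjective.iff_projective (R := R) R).mp inferInstance))
    rwa [zero_add] at this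
  let S : ShortComplex (ModuleCat.{u} R) :=
    ModuleCat.shortComplexOfCompEqZero (Ideal.ofList xs • ⊤ : Submodule R M).subtype
      (Ideal.ofList xs • ⊤ : Submodule R M).mkQ (by ext; simp)
  have hS : S.ShortExact :=
    ModuleCat.shortComplex_shortExact _ (LinearMap.exact_subtype_mkQ _)
      (Submodule.subtype_injective _) (Submodule.mkQ_surjective _)
  have h2 : Subsingleton (Ext N Q xs.length) := by
    refine ⟨fun y z => sub_eq_zero.mp ?_⟩
    generalize y - z = y
    obtain ⟨z, rfl⟩ := Ext.covariant_sequence_exact₃ N hS y rfl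
      (Ext.eq_zero_of_hasProjectiveDimensionLT _ (xs.length + 1) le_rfl)
    obtain rfl : z = 0 := @Subsingleton.elim _ h1 z 0
    apply Ext.zero_comp
  have h3 : Subsingleton (Ext (ModuleCat.of R R) Q 0) := by
    refine subsingleton_ext_of_subsingleton_ext_quotient R Q xs hxs (fun x hx => ?_) 0 ?_
    · rw [Module.mem_annihilator]
      intro m
      obtain ⟨m, rfl⟩ := Submodule.mkQ_surjective _ m
      rw [← map_smul]
      exact (Submodule.Quotient.mk_eq_zero _).mpr
        (Submodule.smul_mem_smul (Ideal.subset_span hx) trivial)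
    · rwa [zero_add]
  have h4 : Subsingleton (ModuleCat.of R R ⟶ Q) := Ext.addEquiv₀.symm.subsingleton
  have h5 : Subsingleton (R →ₗ[R] Q) :=
    (ModuleCat.homAddEquiv (M := ModuleCat.of R R) (N := Q)).symm.subsingleton
  have h6 : Subsingleton Q := (LinearMap.ringLmapEquivSelf R ℕ Q).symm.toEquiv.subsingleton
  exact Submodule.Quotient.subsingleton_iff.mp h6

end ExtRegular

/-! ### Kronecker's theorem through Krull boundary ideals. -/

section Kronecker

variable {R : Type*} [CommRing R]

/-- Otherwise `J` misses the monoid generated by `b` and the complement of `p`; a prime over `J`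
missing it lies inside `p` and omits `b`, against minimality. -/
theorem Ideal.exists_mul_mem_radical_of_mem_minimalPrimes {J p : Ideal R}
    (hp : p ∈ J.minimalPrimes) {b : R} (hb : b ∈ p) : ∃ y ∉ p, y * b ∈ J.radical := by
  have := hp.isPrime
  by_contra! h
  have hdisj : Disjoint (J : Set R) (Submonoid.powers b ⊔ p.primeCompl : Submonoid R) := by
    rw [Set.disjoint_left]
    rintro x hx hx'
    obtain ⟨_, ⟨i, rfl⟩, y, hy, rfl⟩ := Submonoid.mem_sup.mp hx'
    refine h y hy ⟨i + 1, ?_⟩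
    have : (y * b) ^ (i + 1) = (y ^ i * b) * (b ^ i * y) := by ring
    rw [this]
    exact J.mul_mem_left _ hx
  obtain ⟨q, hq, hJq, hdisj'⟩ := Ideal.exists_le_prime_disjoint _ _ hdisj
  have hqp : q ≤ p := fun x hx => by
    by_contra hxp
    exact Set.disjoint_left.mp hdisj' hx (Submonoid.mem_sup_right (show x ∈ p.primeCompl from hxp))
  exact Set.disjoint_left.mp hdisj' (hp.2 ⟨hq, hJq⟩ hqp hb)
    (Submonoid.mem_sup_left (Submonoid.mem_powers b))

/-- The iterated Krull boundary ideal of a list of elements over an ideal. -/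
def iteratedBoundary (J : Ideal R) : List R → Ideal R
  | [] => J
  | b :: bs => iteratedBoundary (J ⊔ Ideal.span {b} ⊔ J.radical.colon {b}) bs

/-- A prime containing `J`, `b` and `(√J : b)` is not minimal over `J`: a minimal prime containing
`b` omits some `y` with `yb ∈ √J`. So each boundary step raises heights by at least one. -/
theorem le_height_of_iteratedBoundary_le (bs : List R) (J : Ideal R) (m : ℕ∞)
    (hJ : ∀ P : Ideal R, P.IsPrime → J ≤ P → m ≤ P.height) (P : Ideal R) [P.IsPrime]
    (hP : iteratedBoundary J bs ≤ P) : m + bs.length ≤ P.height := by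
  induction bs generalizing J m with
  | nil => simpa using hJ P inferInstance hP
  | cons b bs ih =>
    have := ih (J ⊔ Ideal.span {b} ⊔ J.radical.colon {b}) (m + 1) (fun Q hQ hJQ => ?_) hP
    · rwa [List.length_cons, Nat.cast_succ, add_comm (bs.length : ℕ∞), ← add_assoc]
    · obtain ⟨Q₀, hQ₀, hle⟩ := Ideal.exists_minimalPrimes_le (I := J) (J := Q)
        ((le_sup_left.trans le_sup_left).trans hJQ)
      have := hQ₀.isPrime
      have hlt : Q₀ < Q := by
        refine lt_of_le_of_ne hle ?_
        rintro rfl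
        have hb : b ∈ Q₀ :=
          hJQ (Ideal.mem_sup_left (Ideal.mem_sup_right (Ideal.mem_span_singleton_self b)))
        obtain ⟨y, hy, hyb⟩ := Ideal.exists_mul_mem_radical_of_mem_minimalPrimes hQ₀ hb
        exact hy (hJQ (Ideal.mem_sup_right (Submodule.mem_colon_singleton.mpr hyb)))
      grw [hJ Q₀ inferInstance hQ₀.le, Ideal.height_add_one_le_of_lt_of_isPrime hlt]

/-- Replace `b` by `b + ay`, where `y ∈ (√J : b)` is the boundary part of a power of `a`. Modulo `b
+ ay` and `J`, the identity `b² = b(b + ay) - a(yb)` makes `b` nilpotent, and then `ay`, so nothing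
is lost in the radical. -/
theorem exists_mem_radical_of_mem_radical_iteratedBoundary (bs : List R) (J : Ideal R) (a : R)
    (ha : a ∈ (iteratedBoundary J bs).radical) :
    ∃ cs : List R, List.Forall₂ (fun b c => b - c ∈ Ideal.span {a}) bs cs ∧
      a ∈ (J ⊔ Ideal.ofList cs).radical := by
  induction bs generalizing J with
  | nil => exact ⟨[], .nil, by simpa [iteratedBoundary] using ha⟩
  | cons b bs ih =>
    obtain ⟨cs, hcs, hacs⟩ := ih _ ha
    obtain ⟨k, hk⟩ := hacs
    obtain ⟨w, hw, c, hc, hk⟩ := Submodule.mem_sup.mp hk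
    obtain ⟨v, hv, y, hy, rfl⟩ := Submodule.mem_sup.mp hw
    obtain ⟨j, hj, z, hz, rfl⟩ := Submodule.mem_sup.mp hv
    obtain ⟨u, rfl⟩ := Ideal.mem_span_singleton'.mp hz
    rw [Submodule.mem_colon_singleton, smul_eq_mul] at hy
    refine ⟨(b + a * y) :: cs, .cons ?_ hcs, ?_⟩
    · exact Ideal.mem_span_singleton'.mpr ⟨-y, by ring⟩
    · set K := (J ⊔ Ideal.ofList ((b + a * y) :: cs)).radical with hK
      have hrad : K.IsRadical := Ideal.radical_isRadical _
      have hJ : J ≤ K := le_sup_left.trans Ideal.le_radical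
      have hcs' : Ideal.ofList cs ≤ K := by
        rw [hK, Ideal.ofList_cons]
        exact (le_sup_right.trans le_sup_right).trans Ideal.le_radical
      have h0 : b + a * y ∈ K := Ideal.le_radical (Ideal.mem_sup_right
        (Ideal.subset_span List.mem_cons_self))
      have hyb : y * b ∈ K := Ideal.radical_mono le_sup_left hy
      have hb : b ∈ K := hrad ⟨2, by
        rw [show b ^ 2 = b * (b + a * y) - a * (y * b) by ring]
        exact K.sub_mem (K.mul_mem_left _ h0) (K.mul_mem_left _ hyb)⟩
      have hay : a * y ∈ K := by simpa using K.sub_mem h0 hb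
      refine hrad ⟨k + 1, ?_⟩
      rw [pow_succ', ← hk, show a * (j + u * b + y + c) = a * j + a * u * b + a * y + a * c by ring]
      exact K.add_mem (K.add_mem (K.add_mem (K.mul_mem_left _ (hJ hj)) (K.mul_mem_left _ hb)) hay)
        (K.mul_mem_left _ (hcs' hc))

/-- Kronecker's theorem for local rings of finite dimension `n`, without Noetherian hypotheses:
finitely many elements of the maximal ideal lie in the radical of an ideal generated by `n` elements
of the maximal ideal. -/
theorem exists_forall_mem_radical_ofList [IsLocalRing R] (n : ℕ)
    (hn : (IsLocalRing.maximalIdeal R).height = n) (as : List R)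
    (has : ∀ a ∈ as, a ∈ IsLocalRing.maximalIdeal R) :
    ∃ cs : List R, cs.length = n ∧ (∀ c ∈ cs, c ∈ IsLocalRing.maximalIdeal R) ∧
      ∀ a ∈ as, a ∈ (Ideal.ofList cs).radical := by
  induction as with
  | nil => exact ⟨List.replicate n 0, by simp, by simp +contextual [List.mem_replicate], by simp⟩
  | cons a as ih =>
    obtain ⟨bs, hlen, hbs, hbs'⟩ := ih fun a ha => has a (List.mem_cons_of_mem _ ha)
    have ham := has a List.mem_cons_self
    -- A prime over the iterated boundary of `n` elements has height at least `n`, so it is the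
    -- maximal ideal and contains `a`.
    have ha : a ∈ (iteratedBoundary ⊥ bs).radical := by
      rw [Ideal.radical_eq_sInf, Ideal.mem_sInf]
      rintro P ⟨hP, hP'⟩
      have hht := le_height_of_iteratedBoundary_le bs ⊥ 0 (fun _ _ _ => zero_le) P hP
      by_contra haP
      have hlt : P < IsLocalRing.maximalIdeal R :=
        lt_of_le_of_ne (IsLocalRing.le_maximalIdeal hP'.ne_top) (by rintro rfl; exact haP ham)
      have h1 := Ideal.height_add_one_le_of_lt_of_isPrime hlt
      rw [zero_add, hlen] at hht
      grw [hn, ← hht] at h1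
      exact absurd h1 (by norm_cast; omega)
    obtain ⟨cs, hcs, hacs⟩ := exists_mem_radical_of_mem_radical_iteratedBoundary bs ⊥ a ha
    rw [bot_sup_eq] at hacs
    refine ⟨cs, hcs.length_eq ▸ hlen, fun c hc => ?_, ?_⟩
    · obtain ⟨i, hi, rfl⟩ := List.getElem_of_mem hc
      have h1 := hcs.get (i := i) (by rw [hcs.length_eq]; exact hi) hi
      have h2 := (Ideal.span_singleton_le_iff_mem _).mpr ham h1
      have h3 := (IsLocalRing.maximalIdeal R).sub_mem
        (hbs (bs[i]'(by rwa [hcs.length_eq])) (List.getElem_mem _)) h2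
      rwa [List.get_eq_getElem, List.get_eq_getElem, sub_sub_cancel] at h3
    · rintro d (_ | ⟨_, hd⟩)
      · exact hacs
      · have hle : Ideal.ofList bs ≤ (Ideal.ofList cs).radical := by
          refine Ideal.span_le.mpr fun b hb => ?_
          obtain ⟨i, hi, rfl⟩ := List.getElem_of_mem hb
          have h1 := hcs.get (i := i) hi (by rw [← hcs.length_eq]; exact hi)
          have h2 := (Ideal.span_singleton_le_iff_mem _).mpr hacs h1
          have h3 := (Ideal.ofList cs).radical.add_mem h2 (Ideal.le_radical
            (Ideal.subset_span (List.getElem_mem (n := i) (by rwa [← hcs.length_eq]))))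
          rwa [List.get_eq_getElem, List.get_eq_getElem, sub_add_cancel] at h3
        exact (Ideal.radical_isRadical _).radical_le_iff.mpr hle (hbs' d hd)

end Kronecker

/-! ### Polynomial grade is at most height. -/

section UpperBound

open RingTheory.Sequence

universe u

theorem isWeaklyRegular_ofFn_X (R : Type u) [CommRing R] (n : ℕ) :
    IsWeaklyRegular (MvPolynomial (Fin n) R)
      (List.ofFn (MvPolynomial.X : Fin n → MvPolynomial (Fin n) R)) := by
  generalize hxs : List.ofFn (MvPolynomial.X : Fin n → MvPolynomial (Fin n) R) = xs
  rw [isWeaklyRegular_iff_Fin]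
  intro i
  have hi : (i : ℕ) < n := by simpa [← hxs] using i.2
  have h1 : (Ideal.ofList (xs.take i) • ⊤ : Ideal (MvPolynomial (Fin n) R)) =
      Ideal.span (MvPolynomial.X '' {j : Fin n | (j : ℕ) < i}) := by
    rw [smul_eq_mul, Ideal.mul_top]
    refine congrArg Ideal.span (Set.ext fun f => ?_)
    simp only [Set.mem_ofPred_eq, List.mem_take_iff_getElem, Set.mem_image, ← hxs]
    constructor
    · rintro ⟨j, hj, rfl⟩
      exact ⟨⟨j, by simp at hj; omega⟩, by simp at hj; simp; omega, by simp⟩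
    · rintro ⟨j, hj, rfl⟩
      exact ⟨j, by simpa using hj, by simp⟩
  have h2 : xs[i] = MvPolynomial.X ⟨i, hi⟩ := by simp [← hxs]
  rw [h1, h2, isSMulRegular_iff_right_eq_zero_of_smul]
  intro f
  obtain ⟨f, rfl⟩ := Ideal.Quotient.mk_surjective f
  intro hf
  have hf' : MvPolynomial.X ⟨i, hi⟩ * f ∈
      Ideal.span (MvPolynomial.X '' {j : Fin n | (j : ℕ) < i}) := Ideal.Quotient.eq_zero_iff_mem.mp hf
  refine Ideal.Quotient.eq_zero_iff_mem.mpr ?_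
  rw [MvPolynomial.mem_ideal_span_X_image] at hf' ⊢
  intro m hm
  obtain ⟨j, hj, hj'⟩ := hf' (Finsupp.single ⟨i, hi⟩ 1 + m) (by
    rw [MvPolynomial.mem_support_iff, MvPolynomial.coeff_X_mul]
    exact MvPolynomial.mem_support_iff.mp hm)
  refine ⟨j, hj, ?_⟩
  have : (⟨i, hi⟩ : Fin n) ≠ j := by rintro rfl; simp at hj
  simpa [Finsupp.single_apply, this] using hj'

/-- An ideal generated by `n` elements whose radical contains a weakly regular sequence of length
greater than `n` is the unit ideal. -/
theorem ofList_eq_top_of_isWeaklyRegular {S : Type u} [CommRing S] (bs rs : List S)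
    (hlen : bs.length < rs.length) (hrs : ∀ r ∈ rs, r ∈ (Ideal.ofList bs).radical)
    (hreg : IsWeaklyRegular S rs) : Ideal.ofList bs = ⊤ := by
  -- The `bs` need not be regular on `S`. Let `P` act on `S` by `X_i ↦ b_i`: the variables are
  -- regular on `P` and generate an ideal whose extension to `S` is `(bs)`.
  let P := MvPolynomial (Fin bs.length) S
  let φ : P →ₐ[S] S := MvPolynomial.aeval fun i => bs[i]
  let _ : Algebra P S := φ.toRingHom.toAlgebra
  have hC' (s : S) : algebraMap P S (MvPolynomial.C s) = s := MvPolynomial.aeval_C _ s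
  have hX (i : Fin bs.length) : algebraMap P S (MvPolynomial.X i) = bs[i] :=
    MvPolynomial.aeval_X _ i
  let xs : List P := List.ofFn MvPolynomial.X
  have hmap : xs.map (algebraMap P S) = bs := by
    apply List.ext_getElem
    · simp [xs]
    · intro i h1 h2
      simp [xs, hX]
  have hC : (rs.map (MvPolynomial.C : S →+* P)).map (algebraMap P S) = rs := by
    rw [List.map_map]
    conv_rhs => rw [← List.map_id rs]
    refine List.map_congr_left fun r _ => ?_
    simp [hC']
  have hmapI : (Ideal.ofList xs).map (algebraMap P S) = Ideal.ofList bs := by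
    rw [Ideal.map_ofList, hmap]
  have hsurj : Function.Surjective (algebraMap P S) := fun s => ⟨MvPolynomial.C s, hC' s⟩
  have key := ofList_smul_top_eq_top_of_isWeaklyRegular (R := P) S xs (rs.map MvPolynomial.C)
    (isWeaklyRegular_ofFn_X S bs.length) (by simpa [xs] using hlen) (fun r hr => ?_) ?_
  · have h1 : (1 : S) ∈ (Ideal.ofList xs • ⊤ : Submodule P S) := by rw [key]; trivial
    rw [Ideal.smul_top_eq_map, hmapI] at h1
    exact (Ideal.eq_top_iff_one _).mpr h1
  · obtain ⟨r, hr', rfl⟩ := List.mem_map.mp hr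
    obtain ⟨k, hk⟩ := hrs r hr'
    rw [← hmapI, Ideal.mem_map_iff_of_surjective _ hsurj] at hk
    obtain ⟨f, hf, hfk⟩ := hk
    -- Here `f ∈ (X)` maps to `r ^ k`, so the difference acts as zero on `S`.
    refine ⟨k, Submodule.mem_sup.mpr ⟨f, hf, MvPolynomial.C r ^ k - f, ?_, by ring⟩⟩
    rw [Module.mem_annihilator]
    intro s
    rw [Algebra.smul_def, map_sub, hfk, map_pow]
    simp [hC']
  · rw [← isWeaklyRegular_map_algebraMap_iff (R := P) (S := S), hC]
    exact hreg

theorem isWeaklyRegular_tensorProduct_self_iff {R S : Type*} [CommRing R] [CommRing S] [Algebra R S]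
    (rs : List S) : IsWeaklyRegular (S ⊗[R] R) rs ↔ IsWeaklyRegular S rs :=
  (TensorProduct.AlgebraTensorModule.rid R S S).isWeaklyRegular_congr rs

/-- The polynomial grade of a prime ideal is at most its height. -/
theorem polynomialGrade_le_height (A : Type u) [CommRing A] (p : Ideal A) [p.IsPrime] :
    polynomialGrade p A ≤ p.height := by
  refine iSup_le fun m => iSup_le fun rs => iSup_le fun hrs => iSup_le fun hreg => ?_
  by_cases htop : p.height = ⊤
  · simp [htop]
  obtain ⟨n, hn⟩ := ENat.ne_top_iff_exists.mp htop
  rw [← hn]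
  by_contra! hlt
  have hlt : n < rs.length := by exact_mod_cast hlt
  rw [isWeaklyRegular_tensorProduct_self_iff] at hreg
  let R := Localization.AtPrime p
  let S := MvPolynomial (Fin m) R
  let _ : Algebra (MvPolynomial (Fin m) A) S := MvPolynomial.algebraMvPolynomial
  have hreg' : IsWeaklyRegular S (rs.map (algebraMap (MvPolynomial (Fin m) A) S)) :=
    hreg.of_isLocalization S (p.primeCompl.map MvPolynomial.C)
  have hht : (IsLocalRing.maximalIdeal R).height = n := by
    have h1 := IsLocalization.AtPrime.ringKrullDim_eq_height p R
    rw [← IsLocalRing.maximalIdeal_height_eq_ringKrullDim, ← hn] at h1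
    exact_mod_cast h1
  -- Kronecker's theorem is applied to the coefficients, so the number of generators does not depend
  -- on the number `m` of variables.
  let as : List R := rs.flatMap fun f => f.support.toList.map fun d => algebraMap A R (f.coeff d)
  obtain ⟨cs, hcs, hcs', has⟩ := exists_forall_mem_radical_ofList n hht as (by
    intro a ha
    simp only [as, List.mem_flatMap, List.mem_map] at ha
    obtain ⟨f, hf, d, hd, rfl⟩ := ha
    rw [IsLocalization.AtPrime.to_map_mem_maximal_iff R p]
    exact MvPolynomial.mem_map_C_iff.mp (hrs f hf) d)
  have htop' := ofList_eq_top_of_isWeaklyRegular (S := S) (cs.map MvPolynomial.C) _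
    (by simpa [hcs] using hlt) (fun r hr => ?_) hreg'
  · have hle : Ideal.ofList (cs.map (MvPolynomial.C : R →+* S)) ≤
        (IsLocalRing.maximalIdeal R).map MvPolynomial.C := by
      rw [← Ideal.map_ofList]
      exact Ideal.map_mono (Ideal.span_le.mpr hcs')
    rw [htop', top_le_iff, Ideal.eq_top_iff_one, MvPolynomial.mem_map_C_iff] at hle
    have := hle 0
    rw [MvPolynomial.coeff_zero_one] at this
    exact (Ideal.ne_top_iff_one _).mp (IsLocalRing.maximalIdeal.isMaximal R).ne_top this
  · obtain ⟨f, hf, rfl⟩ := List.mem_map.mp hr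
    rw [← Ideal.map_ofList]
    refine Ideal.map_radical_le _ (MvPolynomial.mem_map_C_iff.mpr fun d => ?_)
    rw [MvPolynomial.algebraMap_def, MvPolynomial.coeff_map]
    by_cases hd : d ∈ f.support
    · refine has _ ?_
      simp only [as, List.mem_flatMap, List.mem_map]
      exact ⟨f, hf, d, by simpa using hd, rfl⟩
    · rw [MvPolynomial.notMem_support_iff.mp hd, map_zero]
      exact zero_mem _

end UpperBound

/-! ### Height is at most grade in Cohen-Macaulay rings. -/

section CohenMacaulay

open RingTheory.Sequence Pointwise

universe u

theorem exists_isPrime_smul_eq_zero {R M : Type*} [CommRing R] [IsNoetherianRing R]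
    [AddCommGroup M] [Module R M] {x : M} (hx : x ≠ 0) :
    ∃ P : Ideal R, P.IsPrime ∧ (∀ r : R, r • x = 0 → r ∈ P) ∧
      ∃ z : M, z ≠ 0 ∧ ∀ r ∈ P, r • z = 0 := by
  obtain ⟨P, hP, hxP⟩ := exists_le_isAssociatedPrime_of_isNoetherianRing R x hx
  obtain ⟨hprime, z, hz⟩ := isAssociatedPrime_iff.mp hP
  refine ⟨P, hprime, fun r hr => hxP (by simpa [Submodule.mem_colon_singleton] using hr), z, ?_, ?_⟩
  · rintro rfl
    refine hprime.ne_top ((Ideal.eq_top_iff_one _).mpr ?_)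
    rw [hz, Submodule.mem_colon_singleton]
    simp
  · intro r hr
    rw [hz, Submodule.mem_colon_singleton] at hr
    simpa using hr

/-- The length of a regular sequence on `M` is bounded by the dimension of `R / Q` for every prime
`Q` that annihilates a nonzero element of `M`. -/
theorem length_le_coheight_of_isWeaklyRegular {R M : Type*} [CommRing R] [IsNoetherianRing R]
    [IsLocalRing R] [AddCommGroup M] [Module R M] [Module.Finite R M] (rs : List R)
    (hrs : ∀ r ∈ rs, r ∈ IsLocalRing.maximalIdeal R) (hreg : IsWeaklyRegular M rs)
    (Q : PrimeSpectrum R) (x : M) (hx : x ≠ 0) (hQx : ∀ r ∈ Q.asIdeal, r • x = 0) :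
    (rs.length : ℕ∞) ≤ Order.coheight Q := by
  induction rs generalizing M Q with
  | nil => simp
  | cons r rs ih =>
    rw [isWeaklyRegular_cons_iff] at hreg
    have hrm := hrs r List.mem_cons_self
    let T := Submodule.torsionBySet R M Q.asIdeal
    have hT (y : M) : y ∈ T ↔ ∀ q ∈ Q.asIdeal, q • y = 0 := by
      simp [T, Submodule.mem_torsionBySet_iff]
    -- If `T ⊆ rM`, regularity of `r` gives `T = rT`, and Nakayama kills `T`. So some element of `T`
    -- survives in `M/rM`; an associated prime above its annihilator contains `Q` and `r`, hence is
    -- strictly larger than `Q`.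
    have hnot : ¬ T ≤ r • (⊤ : Submodule R M) := by
      intro hle
      have hbot : T = ⊥ := by
        refine Submodule.eq_bot_of_le_smul_of_le_jacobson_bot (Ideal.span {r}) T
          (IsNoetherian.noetherian T) ?_ ?_
        · intro y hy
          obtain ⟨z, -, rfl⟩ := hle hy
          rw [Submodule.ideal_span_singleton_smul]
          refine Submodule.smul_mem_pointwise_smul _ _ _ ((hT z).mpr fun q hq => ?_)
          have := (hT _).mp hy q hq
          refine hreg.1.right_eq_zero_of_smul ?_
          rw [smul_comm]
          exact this
        · rw [IsLocalRing.jacobson_eq_maximalIdeal ⊥ bot_ne_top, Ideal.span_singleton_le_iff_mem]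
          exact hrm
      exact hx ((Submodule.mem_bot R).mp (hbot ▸ (hT x).mpr hQx))
    obtain ⟨y, hyT, hy⟩ := Set.not_subset.mp hnot
    have hy0 : (Submodule.Quotient.mk y : QuotSMulTop r M) ≠ 0 := fun h =>
      hy ((Submodule.Quotient.mk_eq_zero _).mp h)
    obtain ⟨P, hP, hyP, z, hz, hPz⟩ := exists_isPrime_smul_eq_zero (R := R) hy0
    have hrP : r ∈ P := hyP r (by
      rw [← Submodule.Quotient.mk_smul, Submodule.Quotient.mk_eq_zero]
      exact Submodule.smul_mem_pointwise_smul _ _ _ trivial)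
    have hrQ : r ∉ Q.asIdeal := fun h => hx (hreg.1.right_eq_zero_of_smul (hQx r h))
    have hlt : Q < ⟨P, hP⟩ := by
      refine lt_of_le_of_ne (fun q hq => hyP q ?_) (by rintro rfl; exact hrQ hrP)
      rw [← Submodule.Quotient.mk_smul, (hT y).mp hyT q hq, Submodule.Quotient.mk_zero]
    have := ih (fun r hr => hrs r (List.mem_cons_of_mem _ hr)) hreg.2 ⟨P, hP⟩ z hz hPz
    rw [List.length_cons, Nat.cast_succ]
    grw [this]
    exact Order.coheight_add_one_le hlt

theorem exists_isWeaklyRegular_quotient_ofList {R : Type u} [CommRing R] [IsNoetherianRing R]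
    (I : Ideal R) (M : Type u) [AddCommGroup M] [Module R M] [Module.Finite R M] (n : ℕ)
    (fs rs : List R) (hlen : fs.length + n ≤ rs.length) (hrs : ∀ r ∈ rs, r ∈ I)
    (hreg : IsWeaklyRegular M rs) (hfs : IsWeaklyRegular M fs) :
    ∃ ss : List R, n ≤ ss.length ∧ (∀ r ∈ ss, r ∈ I) ∧
      IsWeaklyRegular (M ⧸ (Ideal.ofList fs • ⊤ : Submodule R M)) ss := by
  induction fs generalizing M rs with
  | nil =>
    refine ⟨rs, by simpa using hlen, hrs, ?_⟩
    exact ((Submodule.quotEquivOfEqBot _ (by simp)).isWeaklyRegular_congr rs).mpr hreg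
  | cons f fs ih =>
    rw [isWeaklyRegular_cons_iff] at hfs
    rw [List.length_cons] at hlen
    obtain ⟨ts, h1, h2, h3⟩ := exists_isWeaklyRegular_quotSMulTop I M (fs.length + n) rs
      (by omega) hrs hreg f hfs.1
    obtain ⟨ss, h4, h5, h6⟩ := ih (QuotSMulTop f M) ts h1.ge h2 h3 hfs.2
    exact ⟨ss, h4, h5, ((Submodule.quotOfListConsSMulTopEquivQuotSMulTopInner M f
      fs).isWeaklyRegular_congr ss).mpr h6⟩

theorem natCast_le_classicalGrade_iff {R M : Type*} [CommRing R] [AddCommGroup M] [Module R M]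
    {I : Ideal R} {n : ℕ} : (n : ℕ∞) ≤ classicalGrade I M ↔
      ∃ rs : List R, n ≤ rs.length ∧ (∀ r ∈ rs, r ∈ I) ∧ IsWeaklyRegular M rs := by
  constructor
  · intro h
    cases n with
    | zero => exact ⟨[], by simp⟩
    | succ n =>
      have h' : (n : ℕ∞) < classicalGrade I M := lt_of_lt_of_le (by norm_cast; omega) h
      simp only [classicalGrade, lt_iSup_iff] at h'
      obtain ⟨rs, h1, h2, h3⟩ := h'
      exact ⟨rs, by exact_mod_cast h3, h1, h2⟩
  · rintro ⟨rs, h1, h2, h3⟩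
    exact (Nat.cast_le.mpr h1).trans
      (le_iSup_of_le rs (le_iSup_of_le h2 (le_iSup_of_le h3 le_rfl)))

/-- In a local Cohen-Macaulay ring, a prime that annihilates a nonzero element modulo a regular
sequence of length `k` has height at most `k`. -/
theorem height_le_length_of_isWeaklyRegular {R : Type u} [CommRing R] [IsNoetherianRing R]
    [IsLocalRing R] (hdepth : ((classicalGrade (IsLocalRing.maximalIdeal R) R : ℕ∞) : WithBot ℕ∞) =
      ringKrullDim R) (fs : List R)
    (hreg : IsWeaklyRegular R fs) (P : Ideal R) (x : R) (hx : x ∉ Ideal.ofList fs)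
    (hPx : ∀ r ∈ P, r * x ∈ Ideal.ofList fs) : P.height ≤ fs.length := by
  have hx' : (Submodule.Quotient.mk x : R ⧸ (Ideal.ofList fs • ⊤ : Submodule R R)) ≠ 0 := by
    rwa [ne_eq, Submodule.Quotient.mk_eq_zero, smul_eq_mul, Ideal.mul_top]
  obtain ⟨Q, hQ, hxQ, z, hz, hQz⟩ := exists_isPrime_smul_eq_zero (R := R) hx'
  have hPQ : P ≤ Q := fun r hr => hxQ r (by
    rw [← Submodule.Quotient.mk_smul, Submodule.Quotient.mk_eq_zero, smul_eq_mul, smul_eq_mul,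
      Ideal.mul_top]
    exact hPx r hr)
  refine (Ideal.height_mono hPQ).trans ?_
  obtain ⟨d, hd⟩ := ENat.ne_top_iff_exists.mp
    (Ideal.height_ne_top (IsLocalRing.maximalIdeal.isMaximal R).ne_top)
  rw [← IsLocalRing.maximalIdeal_height_eq_ringKrullDim, ← hd, WithBot.coe_inj] at hdepth
  have hsum : Q.height + Order.coheight (⟨Q, hQ⟩ : PrimeSpectrum R) ≤ d := by
    have h1 := IsLocalRing.maximalIdeal_height_eq_ringKrullDim (R := R)
    rw [ringKrullDim, Order.krullDim_eq_iSup_height_add_coheight_of_nonempty, ← hd,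
      WithBot.coe_inj] at h1
    rw [h1, show Q.height = _ from PrimeSpectrum.height_eq_orderHeight ⟨Q, hQ⟩]
    exact le_iSup (fun a : PrimeSpectrum R => Order.height a + Order.coheight a) ⟨Q, hQ⟩
  obtain ⟨rs, h1, h2, h3⟩ := natCast_le_classicalGrade_iff.mp hdepth.ge
  -- Exchange leaves `d - fs.length` regular elements modulo `fs`, bounding the coheight of `Q`
  -- below and hence its height above. If `fs` is longer than `d`, the bound `ht Q ≤ d` suffices.
  by_cases hle : fs.length ≤ d
  · obtain ⟨ss, h4, h5, h6⟩ := exists_isWeaklyRegular_quotient_ofList _ R (d - fs.length) fs rs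
      (by omega) h2 h3 hreg
    have h7 := length_le_coheight_of_isWeaklyRegular ss h5 h6 ⟨Q, hQ⟩ z hz hQz
    have h8 : ((d - fs.length : ℕ) : ℕ∞) ≤ Order.coheight (⟨Q, hQ⟩ : PrimeSpectrum R) :=
      (Nat.cast_le.mpr h4).trans h7
    have h9 : Q.height + ((d - fs.length : ℕ) : ℕ∞) ≤ d := le_trans (by gcongr) hsum
    obtain ⟨k, hk⟩ := ENat.ne_top_iff_exists.mp (Ideal.height_ne_top hQ.ne_top)
    rw [← hk] at h9 ⊢
    norm_cast at h9 ⊢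
    omega
  · refine (le_self_add.trans hsum).trans ?_
    exact_mod_cast (not_le.mp hle).le

/-- In a Noetherian Cohen-Macaulay ring the height of a prime is at most its grade. -/
theorem IsNoetherianCohenMacaulay.height_le_classicalGrade {A : Type u} [CommRing A]
    (hA : IsNoetherianCohenMacaulay A) (q : Ideal A) [q.IsPrime] :
    q.height ≤ classicalGrade q A := by
  have := hA.isNoetherianRing
  suffices ∀ n : ℕ, (n : ℕ∞) ≤ q.height →
      ∃ fs : List A, fs.length = n ∧ (∀ r ∈ fs, r ∈ q) ∧ IsWeaklyRegular A fs by
    refine ENat.forall_natCast_le_iff_le.mp fun n hn => ?_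
    obtain ⟨fs, h1, h2, h3⟩ := this n hn
    exact natCast_le_classicalGrade_iff.mpr ⟨fs, h1.ge, h2, h3⟩
  intro n
  induction n with
  | zero => exact fun _ => ⟨[], by simp⟩
  | succ n ih =>
    intro hn
    obtain ⟨fs, hlen, hfs, hreg⟩ := ih (le_trans (by norm_cast; omega) hn)
    by_cases hex : ∃ f ∈ q, IsSMulRegular (A ⧸ (Ideal.ofList fs • ⊤ : Submodule A A)) f
    · obtain ⟨f, hf, hf'⟩ := hex
      refine ⟨fs ++ [f], by simp [hlen], ?_, ?_⟩
      · simpa [or_imp, forall_and] using ⟨hfs, hf⟩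
      · rw [isWeaklyRegular_append_iff, isWeaklyRegular_singleton_iff]
        exact ⟨hreg, hf'⟩
    exfalso
    -- If `fs` cannot be prolonged inside `q`, there is a nonzero map `A/q → A/(fs)`. A lift `a` of
    -- the image of `1` has `qa ⊆ (fs)` and `a ∉ (fs)`; it survives at a maximal ideal over `((fs) :
    -- a)`, where the local bound gives `ht q ≤ fs.length`.
    have hsub : ¬ Subsingleton ((A ⧸ q) →ₗ[A] (A ⧸ (Ideal.ofList fs • ⊤ : Submodule A A))) := by
      rw [IsSMulRegular.subsingleton_linearMap_iff, Ideal.annihilator_quotient]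
      exact hex
    rw [not_subsingleton_iff_nontrivial] at hsub
    obtain ⟨φ, hφ⟩ := exists_ne (0 : (A ⧸ q) →ₗ[A] (A ⧸ (Ideal.ofList fs • ⊤ : Submodule A A)))
    obtain ⟨a, ha⟩ := Submodule.mkQ_surjective _ (φ 1)
    have hker (r : A) : r * a ∈ Ideal.ofList fs ↔ r • φ 1 = 0 := by
      rw [← ha, ← map_smul, Submodule.mkQ_apply, Submodule.Quotient.mk_eq_zero, smul_eq_mul,
        smul_eq_mul, Ideal.mul_top]
    let J : Ideal A := (Ideal.ofList fs).colon {a}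
    have hJ (r : A) : r ∈ J ↔ r * a ∈ Ideal.ofList fs := Submodule.mem_colon_singleton
    have hqJ : q ≤ J := fun r hr => by
      have h1 : r • (1 : A ⧸ q) = 0 := by
        rw [Algebra.smul_def, mul_one]
        exact Ideal.Quotient.eq_zero_iff_mem.mpr hr
      rw [hJ, hker, ← map_smul, h1, map_zero]
    have hJtop : J ≠ ⊤ := by
      intro h
      have h1 := (hker 1).mp ((hJ 1).mp (h ▸ trivial))
      rw [one_smul] at h1
      refine hφ (LinearMap.ext fun x => ?_)
      obtain ⟨x, rfl⟩ := Ideal.Quotient.mk_surjective x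
      have : Ideal.Quotient.mk q x = x • 1 := by
        rw [Algebra.smul_def, mul_one, Ideal.Quotient.algebraMap_eq]
      rw [this, map_smul, h1, smul_zero, LinearMap.zero_apply]
    obtain ⟨m, hm, hJm⟩ := Ideal.exists_le_maximal J hJtop
    let R := Localization.AtPrime m
    have : IsNoetherianRing R := IsLocalization.isNoetherianRing m.primeCompl R inferInstance
    have hqm : Disjoint (m.primeCompl : Set A) (q : Set A) :=
      Set.disjoint_left.mpr fun r hr hrq => hr (hJm (hqJ hrq))
    have hht : (q.map (algebraMap A R)).height ≤ (fs.map (algebraMap A R)).length := by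
      refine height_le_length_of_isWeaklyRegular (hA.depth_eq_ringKrullDim m) _
        (hreg.of_isLocalization R m.primeCompl) _ (algebraMap A R a) ?_ ?_
      · rw [← Ideal.map_ofList, IsLocalization.mem_map_algebraMap_iff m.primeCompl]
        rintro ⟨⟨⟨b, hb⟩, s⟩, h⟩
        rw [← map_mul, IsLocalization.eq_iff_exists m.primeCompl] at h
        obtain ⟨t, ht⟩ := h
        refine (t * s).2 (hJm ((hJ _).mpr ?_))
        rw [Submonoid.coe_mul, mul_assoc, mul_comm (s : A), ht]
        exact Ideal.mul_mem_left _ _ hb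
      · rw [← Ideal.map_ofList]
        have : q.map (algebraMap A R) ≤
            ((Ideal.ofList fs).map (algebraMap A R)).colon {algebraMap A R a} := by
          refine Ideal.map_le_iff_le_comap.mpr fun r hr => ?_
          rw [Ideal.mem_comap, Submodule.mem_colon_singleton, smul_eq_mul, ← map_mul]
          exact Ideal.mem_map_of_mem _ ((hJ r).mp (hqJ hr))
        exact fun r hr => Submodule.mem_colon_singleton.mp (this hr)
    rw [IsLocalization.height_map_of_disjoint m.primeCompl q hqm, List.length_map, hlen] at hht
    exact absurd (hn.trans hht) (by norm_cast; omega)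

end CohenMacaulay

/-! ### Generic sequences in polynomial extensions. -/

section GenericSequence

open RingTheory.Sequence Polynomial Pointwise

universe u v w

/-- The polynomial whose coefficients are the entries of `a`. -/
noncomputable def genericPolynomial {R : Type*} [CommRing R] {k : ℕ} (a : Fin k → R) : R[X] :=
  ∑ i, C (a i) * X ^ (i : ℕ)

theorem coeff_genericPolynomial {R : Type*} [CommRing R] {k : ℕ} (a : Fin k → R) (i : Fin k) :
    (genericPolynomial a).coeff i = a i := by
  simp only [genericPolynomial, finsetSum_coeff, coeff_C_mul, coeff_X_pow]
  rw [Finset.sum_eq_single i]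
  · simp
  · intro j _ hj
    rw [if_neg (fun h => hj (Fin.ext h.symm)), mul_zero]
  · simp

theorem map_genericPolynomial {R S : Type*} [CommRing R] [CommRing S] (φ : R →+* S) {k : ℕ}
    (a : Fin k → R) : (genericPolynomial a).map φ = genericPolynomial fun i => φ (a i) := by
  simp [genericPolynomial, Polynomial.map_sum]

theorem genericPolynomial_mem_map_C {R : Type*} [CommRing R] {k : ℕ} (a : Fin k → R) :
    genericPolynomial a ∈ (Ideal.span (Set.range a)).map C :=
  Ideal.sum_mem _ fun i _ => Ideal.mul_mem_right _ _
    (Ideal.mem_map_of_mem _ (Ideal.subset_span ⟨i, rfl⟩))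

/-- The iterated generic polynomials in the entries of `a` form a regular sequence of length `n`:
the first one is regular on `R[X]`, and so on for the quotient of `R[X]` by it. -/
def GenericallyRegular : ℕ → ∀ (R : Type u) [CommRing R] {k : ℕ}, (Fin k → R) → Prop
  | 0, _, _, _, _ => True
  | n + 1, R, _, _, a => genericPolynomial a ∈ nonZeroDivisors R[X] ∧
      GenericallyRegular n (R[X] ⧸ Ideal.span {genericPolynomial a})
        fun i => Ideal.Quotient.mk _ (C (a i))

theorem isSMulRegular_of_mem_nonZeroDivisors {R : Type*} [CommRing R] {r : R}
    (hr : r ∈ nonZeroDivisors R) : IsSMulRegular R r :=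
  isSMulRegular_iff_right_eq_zero_of_smul.mpr fun x hx =>
    mem_nonZeroDivisors_iff_right.mp hr x (by rwa [mul_comm])

/-- By McCoy's theorem a zero divisor in `R[X]` is killed by a nonzero constant. Such a constant
would kill every `a i`, hence the first term of `rs`, which is regular. Dividing by the generic
polynomial then costs only one unit of length, by exchange over `R[X]`. -/
theorem genericallyRegular_of_isWeaklyRegular (n : ℕ) (R : Type u) [CommRing R] [IsNoetherianRing R]
    {k : ℕ} (a : Fin k → R) (rs : List R) (hlen : n ≤ rs.length)
    (hrs : ∀ r ∈ rs, r ∈ Ideal.span (Set.range a)) (hreg : IsWeaklyRegular R rs) :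
    GenericallyRegular n R a := by
  induction n generalizing R rs with
  | zero => trivial
  | succ n ih =>
    have hnzd : genericPolynomial a ∈ nonZeroDivisors R[X] := by
      rw [Polynomial.mem_nonZeroDivisors_iff]
      intro b hb
      obtain _ | ⟨r, rs⟩ := rs
      · simp at hlen
      refine ((isWeaklyRegular_cons_iff _ _ _).mp hreg).1.right_eq_zero_of_smul ?_
      have hle : Ideal.span (Set.range a) ≤ (⊥ : Ideal R).colon {b} := by
        refine Ideal.span_le.mpr ?_
        rintro _ ⟨i, rfl⟩
        have := congrArg (fun q => q.coeff (i : ℕ)) hb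
        simp only [coeff_smul, coeff_genericPolynomial, coeff_zero, smul_eq_mul] at this
        simpa [Submodule.mem_colon_singleton, mul_comm] using this
      simpa [Submodule.mem_colon_singleton] using hle (hrs r List.mem_cons_self)
    refine ⟨hnzd, ?_⟩
    set h := genericPolynomial a
    obtain ⟨ss, h1, h2, h3⟩ := exists_isWeaklyRegular_quotSMulTop
      ((Ideal.span (Set.range a)).map C) R[X] n (rs.map (algebraMap R R[X])) (by simpa using hlen)
      (fun r hr => by
        obtain ⟨r, hr', rfl⟩ := List.mem_map.mp hr
        exact Ideal.mem_map_of_mem C (hrs r hr'))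
      hreg.of_flat h (isSMulRegular_of_mem_nonZeroDivisors hnzd)
    have heq : h • (⊤ : Submodule R[X] R[X]) = Ideal.span {h} := by
      rw [← Submodule.ideal_span_singleton_smul, smul_eq_mul, Ideal.mul_top]
    have h4 : IsWeaklyRegular (R[X] ⧸ Ideal.span {h}) ss :=
      ((Submodule.quotEquivOfEq _ _ heq).isWeaklyRegular_congr ss).mp h3
    refine ih (R[X] ⧸ Ideal.span {h}) _ (ss.map (algebraMap R[X] (R[X] ⧸ Ideal.span {h})))
      (by simp [h1]) (fun r hr => ?_) ((isWeaklyRegular_map_algebraMap_iff _ _ ss).mpr h4)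
    obtain ⟨s, hs, rfl⟩ := List.mem_map.mp hr
    have := Ideal.mem_map_of_mem (Ideal.Quotient.mk (Ideal.span {h})) (h2 s hs)
    rwa [Ideal.map_span, Ideal.map_span, ← Set.range_comp, ← Set.range_comp] at this

theorem RingEquiv.isWeaklyRegular_map {R S : Type*} [CommRing R] [CommRing S] (e : R ≃+* S)
    {rs : List R} (h : IsWeaklyRegular R rs) : IsWeaklyRegular S (rs.map e) :=
  (e.toAddEquiv.isWeaklyRegular_congr (List.forall₂_map_right_iff.mpr
    (List.forall₂_same.mpr fun r _ x => map_mul e r x))).mp h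

/-- Weakly regular sequences lift along a surjection whose kernel is generated by a regular
element. -/
theorem isWeaklyRegular_cons_of_surjective {B D : Type*} [CommRing B] [CommRing D] (φ : B →+* D)
    (hφ : Function.Surjective φ) (h : B) (hker : RingHom.ker φ = Ideal.span {h})
    (hreg : h ∈ nonZeroDivisors B) (ts : List B) (hts : IsWeaklyRegular D (ts.map φ)) :
    IsWeaklyRegular B (h :: ts) := by
  let _ : Algebra B D := φ.toAlgebra
  have heq : h • (⊤ : Submodule B B) = LinearMap.ker (Algebra.linearMap B D) := by
    rw [← Submodule.ideal_span_singleton_smul, smul_eq_mul, Ideal.mul_top, ← hker]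
    rfl
  have e : QuotSMulTop h B ≃ₗ[B] D := (Submodule.quotEquivOfEq _ _ heq).trans
    ((Algebra.linearMap B D).quotKerEquivOfSurjective hφ)
  rw [isWeaklyRegular_cons_iff, e.isWeaklyRegular_congr]
  exact ⟨isSMulRegular_of_mem_nonZeroDivisors hreg,
    (isWeaklyRegular_map_algebraMap_iff (S := D) D ts).mp hts⟩

theorem exists_isWeaklyRegular_mvPolynomial_cons {S : Type*} [CommRing S] (σ : Type*) {h : S}
    (hh : h ∈ nonZeroDivisors S) (I : Ideal S) (ss : List (MvPolynomial σ (S ⧸ Ideal.span {h})))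
    (hss : ∀ s ∈ ss, s ∈ (I.map (Ideal.Quotient.mk (Ideal.span {h}))).map MvPolynomial.C)
    (hreg : IsWeaklyRegular (MvPolynomial σ (S ⧸ Ideal.span {h})) ss) :
    ∃ ts : List (MvPolynomial σ S), ts.length = ss.length ∧
      (∀ t ∈ ts, t ∈ I.map MvPolynomial.C) ∧
      IsWeaklyRegular (MvPolynomial σ S) (MvPolynomial.C h :: ts) := by
  let φ : MvPolynomial σ S →+* MvPolynomial σ (S ⧸ Ideal.span {h}) :=
    MvPolynomial.map (Ideal.Quotient.mk (Ideal.span {h}))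
  have hφ : Function.Surjective φ := MvPolynomial.map_surjective _ Ideal.Quotient.mk_surjective
  have hI : (I.map MvPolynomial.C).map φ =
      (I.map (Ideal.Quotient.mk (Ideal.span {h}))).map MvPolynomial.C := by
    rw [Ideal.map_map, Ideal.map_map]
    exact congrArg (fun ψ => Ideal.map ψ I) (RingHom.ext fun s => MvPolynomial.map_C _ _)
  have hlift : ∃ ts : List (MvPolynomial σ S), ts.map φ = ss ∧ ∀ t ∈ ts, t ∈ I.map MvPolynomial.C := by
    clear hreg
    induction ss with
    | nil => exact ⟨[], by simp⟩
    | cons s ss ih =>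
      obtain ⟨ts, rfl, hts⟩ := ih fun s hs => hss s (List.mem_cons_of_mem _ hs)
      have hs := hss s List.mem_cons_self
      rw [← hI, Ideal.mem_map_iff_of_surjective φ hφ] at hs
      obtain ⟨t, ht, rfl⟩ := hs
      exact ⟨t :: ts, rfl, List.forall_mem_cons.mpr ⟨ht, hts⟩⟩
  obtain ⟨ts, rfl, hts⟩ := hlift
  refine ⟨ts, by simp, hts, isWeaklyRegular_cons_of_surjective φ hφ _ ?_ ?_ ts hreg⟩
  · rw [MvPolynomial.ker_map, Ideal.mk_ker, Ideal.map_span, Set.image_singleton]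
  · refine mem_nonZeroDivisors_iff_right.mpr fun x hx => MvPolynomial.ext _ _ fun d => ?_
    have := congrArg (MvPolynomial.coeff d) hx
    rw [mul_comm, MvPolynomial.coeff_C_mul, MvPolynomial.coeff_zero, mul_comm] at this
    rw [mem_nonZeroDivisors_iff_right.mp hh _ this, MvPolynomial.coeff_zero]

theorem GenericallyRegular.exists_isWeaklyRegular_mvPolynomial (n : ℕ) (R : Type u) [CommRing R]
    {k : ℕ} (a : Fin k → R) (ha : GenericallyRegular n R a) :
    ∃ (σ : Type) (_ : Finite σ) (rs : List (MvPolynomial σ R)), rs.length = n ∧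
      (∀ r ∈ rs, r ∈ (Ideal.span (Set.range a)).map (MvPolynomial.C : R →+* MvPolynomial σ R)) ∧
      IsWeaklyRegular (MvPolynomial σ R) rs := by
  induction n generalizing R with
  | zero => exact ⟨Empty, inferInstance, [], by simp⟩
  | succ n ih =>
    obtain ⟨hnzd, ha⟩ := ha
    set h := genericPolynomial a
    obtain ⟨σ, hσ, ss, hlen, hss, hreg⟩ := ih _ _ ha
    have hmap : (Ideal.span (Set.range fun i => Ideal.Quotient.mk (Ideal.span {h}) (C (a i)))) =
        ((Ideal.span (Set.range a)).map C).map (Ideal.Quotient.mk (Ideal.span {h})) := by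
      rw [Ideal.map_span, Ideal.map_span, ← Set.range_comp, ← Set.range_comp]
      rfl
    rw [hmap] at hss
    obtain ⟨ts, hts, htsJ, hB⟩ := exists_isWeaklyRegular_mvPolynomial_cons σ hnzd _ ss hss hreg
    -- The variable of `R[X]` becomes the extra variable `none`.
    let e := (MvPolynomial.optionEquivRight R σ).symm.toRingEquiv
    have heJ : (((Ideal.span (Set.range a)).map C).map MvPolynomial.C).map
        (e : MvPolynomial σ R[X] →+* MvPolynomial (Option σ) R) ≤
          (Ideal.span (Set.range a)).map MvPolynomial.C := by
      simp only [Ideal.map_map]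
      refine le_of_eq (congrArg (fun ψ => Ideal.map ψ _) (RingHom.ext fun r => ?_))
      change (MvPolynomial.optionEquivRight R σ).symm (MvPolynomial.C (C r)) = MvPolynomial.C r
      rw [AlgEquiv.symm_apply_eq, MvPolynomial.optionEquivRight_C]
    refine ⟨Option σ, inferInstance, _, by simp [hts, hlen], fun r hr => ?_, e.isWeaklyRegular_map hB⟩
    obtain ⟨b, hb, rfl⟩ := List.mem_map.mp hr
    refine heJ (Ideal.mem_map_of_mem _ ?_)
    obtain _ | ⟨_, hb⟩ := hb
    · exact Ideal.mem_map_of_mem _ (genericPolynomial_mem_map_C a)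
    · exact htsJ b hb

theorem GenericallyRegular.le_polynomialGrade {n : ℕ} {R : Type u} [CommRing R] {k : ℕ}
    {a : Fin k → R} (ha : GenericallyRegular n R a) {I : Ideal R} (hI : ∀ i, a i ∈ I) :
    (n : ℕ∞) ≤ polynomialGrade I R := by
  obtain ⟨σ, _, rs, hlen, hrs, hreg⟩ := ha.exists_isWeaklyRegular_mvPolynomial
  obtain ⟨m, ⟨ε⟩⟩ := Finite.exists_equiv_fin σ
  let e := (MvPolynomial.renameEquiv R ε).toRingEquiv
  refine le_iSup_of_le m (natCast_le_classicalGrade_iff.mpr ⟨rs.map e, by simp [hlen], ?_, ?_⟩)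
  · intro r hr
    obtain ⟨s, hs, rfl⟩ := List.mem_map.mp hr
    have h1 := Ideal.mem_map_of_mem (e : MvPolynomial σ R →+* MvPolynomial (Fin m) R) (hrs s hs)
    rw [Ideal.map_map] at h1
    have h2 : (e : MvPolynomial σ R →+* MvPolynomial (Fin m) R).comp MvPolynomial.C =
        MvPolynomial.C := RingHom.ext fun r => MvPolynomial.rename_C _ r
    rw [h2] at h1
    exact Ideal.map_mono (Ideal.span_le.mpr (Set.range_subset_iff.mpr hI)) h1
  · exact (isWeaklyRegular_tensorProduct_self_iff _).mpr (e.isWeaklyRegular_map hreg)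

end GenericSequence

/-! ### Passage to directed colimits. -/

section Colimit

open Polynomial

universe v w

/-- `L` is the colimit of the directed system of rings `C`. -/
structure IsRingColimit {Γ : Type*} [Preorder Γ] (C : Γ → Type v) [∀ γ, CommRing (C γ)]
    (f : ∀ γ δ : Γ, γ ≤ δ → C γ →+* C δ) (L : Type w) [CommRing L] (φ : ∀ γ, C γ →+* L) :
    Prop where
  map_map : ∀ γ δ ε (h : γ ≤ δ) (h' : δ ≤ ε) x, f δ ε h' (f γ δ h x) = f γ ε (h.trans h') x
  comp_map : ∀ γ δ (h : γ ≤ δ) x, φ δ (f γ δ h x) = φ γ x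
  exists_of : ∀ x, ∃ γ y, φ γ y = x
  exact : ∀ γ x, φ γ x = 0 → ∃ δ, ∃ h : γ ≤ δ, f γ δ h x = 0

namespace IsRingColimit

variable {Γ : Type*} [Preorder Γ] {C : Γ → Type v} [∀ γ, CommRing (C γ)]
  {f : ∀ γ δ : Γ, γ ≤ δ → C γ →+* C δ} {L : Type w} [CommRing L] {φ : ∀ γ, C γ →+* L}

theorem polynomial [Nonempty Γ] [IsDirectedOrder Γ] (hC : IsRingColimit C f L φ) :
    IsRingColimit (fun γ => (C γ)[X]) (fun γ δ h => mapRingHom (f γ δ h)) L[X]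
      (fun γ => mapRingHom (φ γ)) where
  map_map γ δ ε h h' x := by ext i; simp [hC.map_map]
  comp_map γ δ h x := by ext i; simp [hC.comp_map]
  exists_of x := by
    induction x using Polynomial.induction_on' with
    | add p q hp hq =>
      obtain ⟨γ, p, rfl⟩ := hp
      obtain ⟨δ, q, rfl⟩ := hq
      obtain ⟨ε, h, h'⟩ := exists_ge_ge γ δ
      refine ⟨ε, mapRingHom (f γ ε h) p + mapRingHom (f δ ε h') q, ?_⟩
      ext i
      simp [hC.comp_map]
    | monomial n r =>
      obtain ⟨γ, y, rfl⟩ := hC.exists_of r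
      exact ⟨γ, monomial n y, by simp⟩
  exact γ x hx := by
    classical
    have hcoeff (i : ℕ) : φ γ (x.coeff i) = 0 := by
      have := congrArg (fun q => q.coeff i) hx
      simpa using this
    choose δ hδ hδ' using fun i => hC.exact γ (x.coeff i) (hcoeff i)
    obtain ⟨M, hM⟩ := Finset.exists_le (insert γ (x.support.image δ))
    refine ⟨M, hM γ (Finset.mem_insert_self _ _), ?_⟩
    ext i
    rw [coe_mapRingHom, coeff_map, coeff_zero]
    by_cases hi : i ∈ x.support
    · rw [← hC.map_map γ (δ i) M (hδ i)
        (hM _ (Finset.mem_insert_of_mem (Finset.mem_image_of_mem _ hi))), hδ', map_zero]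
    · rw [notMem_support_iff.mp hi, map_zero]

theorem mem_nonZeroDivisors (hC : IsRingColimit C f L φ) {h : ∀ γ, C γ} {l : L}
    (hf : ∀ γ δ hle, f γ δ hle (h γ) = h δ) (hφ : ∀ γ, φ γ (h γ) = l)
    (hreg : ∀ γ, h γ ∈ nonZeroDivisors (C γ)) : l ∈ nonZeroDivisors L := by
  rw [mem_nonZeroDivisors_iff_right]
  intro z hz
  obtain ⟨γ, w, rfl⟩ := hC.exists_of z
  rw [← hφ γ, ← map_mul] at hz
  obtain ⟨δ, hle, h0⟩ := hC.exact _ _ hz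
  rw [map_mul, hf] at h0
  rw [← hC.comp_map γ δ hle, mem_nonZeroDivisors_iff_right.mp (hreg δ) _ h0, map_zero]

theorem span_le_comap {R S : Type*} [CommRing R] [CommRing S] (ψ : R →+* S) {x : R} {y : S}
    (h : ψ x = y) : Ideal.span {x} ≤ (Ideal.span {y}).comap ψ := by
  rw [Ideal.span_singleton_le_iff_mem, Ideal.mem_comap, h]
  exact Ideal.mem_span_singleton_self y

theorem quotient [IsDirectedOrder Γ] (hC : IsRingColimit C f L φ) {h : ∀ γ, C γ} {l : L}
    (hf : ∀ γ δ hle, f γ δ hle (h γ) = h δ) (hφ : ∀ γ, φ γ (h γ) = l) :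
    IsRingColimit (fun γ => C γ ⧸ Ideal.span {h γ})
      (fun γ δ hle => Ideal.quotientMap _ (f γ δ hle) (span_le_comap _ (hf γ δ hle)))
      (L ⧸ Ideal.span {l}) (fun γ => Ideal.quotientMap _ (φ γ) (span_le_comap _ (hφ γ))) where
  map_map γ δ ε hle hle' x := by
    obtain ⟨x, rfl⟩ := Ideal.Quotient.mk_surjective x
    simp [hC.map_map]
  comp_map γ δ hle x := by
    obtain ⟨x, rfl⟩ := Ideal.Quotient.mk_surjective x
    simp [hC.comp_map]
  exists_of x := by
    obtain ⟨x, rfl⟩ := Ideal.Quotient.mk_surjective x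
    obtain ⟨γ, y, rfl⟩ := hC.exists_of x
    exact ⟨γ, Ideal.Quotient.mk _ y, by simp⟩
  exact γ x hx := by
    obtain ⟨x, rfl⟩ := Ideal.Quotient.mk_surjective x
    rw [Ideal.quotientMap_mk, Ideal.Quotient.eq_zero_iff_mem] at hx
    obtain ⟨z, hz⟩ := Ideal.mem_span_singleton'.mp hx
    obtain ⟨ε, w, rfl⟩ := hC.exists_of z
    obtain ⟨μ, h1, h2⟩ := exists_ge_ge γ ε
    obtain ⟨δ, h3, h4⟩ := hC.exact μ (f ε μ h2 w * h μ - f γ μ h1 x) (by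
      rw [map_sub, map_mul, hC.comp_map, hC.comp_map, hφ, hz, sub_self])
    refine ⟨δ, h1.trans h3, ?_⟩
    rw [Ideal.quotientMap_mk, Ideal.Quotient.eq_zero_iff_mem]
    rw [map_sub, map_mul, hf, hC.map_map γ μ δ, sub_eq_zero] at h4
    exact Ideal.mem_span_singleton'.mpr ⟨_, h4⟩

end IsRingColimit

/-- Polynomial rings and quotients by compatible elements commute with directed colimits, and a
compatible family of non-zero-divisors has a non-zero-divisor as limit. No flatness of the
transition maps is needed. -/
theorem GenericallyRegular.of_isRingColimit {Γ : Type*} [Preorder Γ] [IsDirectedOrder Γ]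
    [Nonempty Γ] (n : ℕ) (C : Γ → Type v) [∀ γ, CommRing (C γ)]
    (f : ∀ γ δ : Γ, γ ≤ δ → C γ →+* C δ) (L : Type w) [CommRing L] (φ : ∀ γ, C γ →+* L)
    (hC : IsRingColimit C f L φ) {k : ℕ} (a : ∀ γ, Fin k → C γ) (b : Fin k → L)
    (hf : ∀ γ δ hle i, f γ δ hle (a γ i) = a δ i) (hφ : ∀ γ i, φ γ (a γ i) = b i)
    (ha : ∀ γ, GenericallyRegular n (C γ) (a γ)) : GenericallyRegular n L b := by
  induction n generalizing C L with
  | zero => trivial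
  | succ n ih =>
    have hf' (γ δ hle) : mapRingHom (f γ δ hle) (genericPolynomial (a γ)) =
        genericPolynomial (a δ) := by
      rw [coe_mapRingHom, map_genericPolynomial]
      exact congrArg genericPolynomial (funext (hf γ δ hle))
    have hφ' (γ) : mapRingHom (φ γ) (genericPolynomial (a γ)) = genericPolynomial b := by
      rw [coe_mapRingHom, map_genericPolynomial]
      exact congrArg genericPolynomial (funext (hφ γ))
    refine ⟨hC.polynomial.mem_nonZeroDivisors hf' hφ' fun γ => (ha γ).1, ?_⟩
    refine ih _ _ _ _ (hC.polynomial.quotient hf' hφ') _ _ ?_ ?_ fun γ => (ha γ).2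
    · intro γ δ hle i
      simp [hf]
    · intro γ i
      simp [hφ]

end Colimit

/-! ### Heights at finite stages and the main theorem. -/

section Main

/-- One element witnesses each strict inclusion of a finite chain of primes, and finitely many
elements come from a common stage. -/
theorem exists_forall_le_height_comap {Γ : Type*} [Preorder Γ] [Nonempty Γ] [IsDirectedOrder Γ]
    (G : Γ → Type*) [∀ γ, CommRing (G γ)] (f : ∀ δ γ : Γ, δ ≤ γ → G δ →+* G γ)
    (p : Ideal (Ring.DirectLimit G fun δ γ h => f δ γ h)) [p.IsPrime] (n : ℕ)
    (hn : (n : ℕ∞) ≤ p.height) :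
    ∃ δ, ∀ γ, δ ≤ γ →
      (n : ℕ∞) ≤ (p.comap (Ring.DirectLimit.of G (fun δ γ h => f δ γ h) γ)).height := by
  classical
  rw [show p.height = _ from PrimeSpectrum.height_eq_orderHeight ⟨p, inferInstance⟩] at hn
  obtain ⟨l, hl, rfl⟩ := Order.exists_series_of_le_height _ hn
  have hex (i : Fin l.length) : ∃ γ y,
      Ring.DirectLimit.of G (fun δ γ h => f δ γ h) γ y ∈ (l i.succ).asIdeal ∧
      Ring.DirectLimit.of G (fun δ γ h => f δ γ h) γ y ∉ (l i.castSucc).asIdeal := by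
    obtain ⟨x, hx, hx'⟩ := Set.exists_of_ssubset (l.step i)
    obtain ⟨γ, y, rfl⟩ := Ring.DirectLimit.exists_of x
    exact ⟨γ, y, hx, hx'⟩
  choose γ' y hy hy' using hex
  obtain ⟨δ, hδ⟩ := Finset.exists_le (Finset.univ.image γ')
  refine ⟨δ, fun γ hγ => ?_⟩
  let q : LTSeries (PrimeSpectrum (G γ)) :=
    { length := l.length
      toFun := fun i => PrimeSpectrum.comap (Ring.DirectLimit.of G (fun δ γ h => f δ γ h) γ) (l i)
      step := fun i => by
        have hle : γ' i ≤ γ := (hδ _ (Finset.mem_image_of_mem _ (Finset.mem_univ i))).trans hγ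
        refine lt_of_le_of_ne (Ideal.comap_mono (l.step i).le) fun h => hy' i ?_
        have h1 : f (γ' i) γ hle (y i) ∈ (l i.succ).asIdeal.comap
            (Ring.DirectLimit.of G (fun δ γ h => f δ γ h) γ) := by
          rw [Ideal.mem_comap, Ring.DirectLimit.of_f]
          exact hy i
        rw [← (show (l i.castSucc).asIdeal.comap _ = _ from h), Ideal.mem_comap,
          Ring.DirectLimit.of_f] at h1
        exact h1 }
  have hq : q.last.asIdeal = p.comap (Ring.DirectLimit.of G (fun δ γ h => f δ γ h) γ) := by
    change (PrimeSpectrum.comap _ l.last).asIdeal = _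
    rw [hl]
    rfl
  rw [← hq, PrimeSpectrum.height_eq_orderHeight]
  exact Order.length_le_height_last (p := q)

/-- `A = Ring.DirectLimit G f` is the direct limit of a filtered direct system of Noetherian
Cohen-Macaulay rings `G γ`, and `p_γ = p ∩ G γ` is the preimage of `p` under the canonical map
`G γ → A`. -/
theorem proposition3p5 {Γ : Type*} [Preorder Γ] [Nonempty Γ] [IsDirectedOrder Γ]
    (G : Γ → Type*) [∀ γ, CommRing (G γ)]
    (f : ∀ δ γ : Γ, δ ≤ γ → G δ →+* G γ)
    [DirectedSystem G fun δ γ h => f δ γ h]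
    (hCM : ∀ γ, IsNoetherianCohenMacaulay (G γ))
    (p : Ideal (Ring.DirectLimit G fun δ γ h => f δ γ h)) [p.IsPrime]
    (h :
      (∀ (δ γ : Γ) (hle : δ ≤ γ),
        classicalGrade (p.comap (Ring.DirectLimit.of G (fun δ γ h => f δ γ h) γ)) (G γ) =
          classicalGrade
            ((p.comap (Ring.DirectLimit.of G (fun δ γ h => f δ γ h) δ)).map (f δ γ hle)) (G γ)) ∨
      (∀ (δ γ : Γ) (hle : δ ≤ γ),
        classicalGrade (p.comap (Ring.DirectLimit.of G (fun δ γ h => f δ γ h) δ)) (G δ) ≤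
          classicalGrade
            ((p.comap (Ring.DirectLimit.of G (fun δ γ h => f δ γ h) δ)).map (f δ γ hle)) (G γ))) :
    polynomialGrade p (Ring.DirectLimit G fun δ γ h => f δ γ h) = p.height := by
  refine le_antisymm (polynomialGrade_le_height _ p) ?_
  refine ENat.forall_natCast_le_iff_le.mp fun n hn => ?_
  obtain ⟨δ, hδ⟩ := exists_forall_le_height_comap G f p n hn
  let ι := Ring.DirectLimit.of G (fun δ γ h => f δ γ h)
  -- Under (i) height is compared with grade at `γ`, under (ii) at `δ`.
  have hgrade (γ : Γ) (hle : δ ≤ γ) :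
      (n : ℕ∞) ≤ classicalGrade ((p.comap (ι δ)).map (f δ γ hle)) (G γ) := by
    rcases h with h | h
    · exact (hδ γ hle).trans (((hCM γ).height_le_classicalGrade _).trans (h δ γ hle).le)
    · exact (hδ δ le_rfl).trans (((hCM δ).height_le_classicalGrade _).trans (h δ γ hle))
  have := (hCM δ).isNoetherianRing
  obtain ⟨k, a, ha⟩ := Submodule.fg_iff_exists_fin_generating_family.mp
    (IsNoetherian.noetherian (p.comap (ι δ)))
  have ha' : Ideal.span (Set.range a) = p.comap (ι δ) := ha
  have hdir : IsDirectedOrder {γ // δ ≤ γ} := ⟨fun γ ε => by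
    obtain ⟨μ, h1, h2⟩ := exists_ge_ge γ.1 ε.1
    exact ⟨⟨μ, γ.2.trans h1⟩, h1, h2⟩⟩
  have : Nonempty {γ // δ ≤ γ} := ⟨⟨δ, le_rfl⟩⟩
  -- The generators of `p_δ` exist only from `δ` on, so the colimit is taken over the cofinal set of
  -- `γ ≥ δ`.
  have hcolim : IsRingColimit (fun γ : {γ // δ ≤ γ} => G γ) (fun γ ε h => f γ ε h)
      (Ring.DirectLimit G fun δ γ h => f δ γ h) (fun γ => ι γ) :=
    { map_map := fun γ ε μ h h' x => DirectedSystem.map_map' (f := fun δ γ h => f δ γ h) h h' x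
      comp_map := fun γ ε h x => Ring.DirectLimit.of_f _ _
      exists_of := fun x => by
        obtain ⟨γ, y, rfl⟩ := Ring.DirectLimit.exists_of x
        obtain ⟨ε, h1, h2⟩ := exists_ge_ge γ δ
        exact ⟨⟨ε, h2⟩, f γ ε h1 y, Ring.DirectLimit.of_f _ _⟩
      exact := fun γ x hx => by
        obtain ⟨ε, h1, h2⟩ := Ring.DirectLimit.of.zero_exact hx
        exact ⟨⟨ε, γ.2.trans h1⟩, h1, h2⟩ }
  refine GenericallyRegular.le_polynomialGrade (a := fun i => ι δ (a i)) ?_ fun i => ?_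
  · refine GenericallyRegular.of_isRingColimit n _ _ _ _ hcolim
      (fun γ i => f δ γ γ.2 (a i)) _ ?_ ?_ fun γ => ?_
    · exact fun γ ε hle i => DirectedSystem.map_map' (f := fun δ γ h => f δ γ h) γ.2 hle (a i)
    · exact fun γ i => Ring.DirectLimit.of_f _ _
    · obtain ⟨rs, h1, h2, h3⟩ := natCast_le_classicalGrade_iff.mp (hgrade γ γ.2)
      have := (hCM γ).isNoetherianRing
      refine genericallyRegular_of_isWeaklyRegular n (G γ) _ rs h1 (fun r hr => ?_) h3
      have := h2 r hr
      rwa [← ha', Ideal.map_span, ← Set.range_comp] at this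
  · exact (show Ideal.span (Set.range a) ≤ _ from ha'.le) (Ideal.subset_span ⟨i, rfl⟩)

end Main
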